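/- Let $P$ be a finite poset with a unique minimal element $\hat 0$ and a unique maximal element $\hat 1$, all of whose intervals are graded, with rank function $\rho$ (so $\rho(\hat 0)=0$), and let $n=\rho(\hat 1)\ge 3$ be its rank. For $x\le y$ call $[x,y]$ an $m$-interval if $\rho(y)-\rho(x)=m$. Assume the following. (a) $P$ is Eulerian: every interval $[x,y]$ with $x<y$ has as many elements of even rank as of odd rank. (b) $P$ is a Sheffer poset with Sheffer factorial function $D$ and binomial factorial function $B$: for each $m$, every $m$-interval $[\hat 0,y]$ has the same number $D(m)$ of maximal chains, and every $m$-interval $[x,y]$ with $x\neq\hat 0$ has the same number $B(m)$ of maximal chains. (c) $B(3)=D(3)=6$, that is, every $3$-interval of $P$ has exactly $6$ maximal chains. (If $n=3$, there is no $3$-interval $[x,y]$ with $x\ne\hat 0$, and the condition on $B(3)$ is empty.) Let $B_n$ denote the boolean lattice of all subsets of $\{1,\dots,n\}$ ordered by inclusion, and for an integer $k\ge1$ let $\boxplus^k(B_n)$, the $k$-summation of $B_n$, be the poset obtained from $k$ disjoint copies of $B_n$ by identifying all the minimal elements with one another and all the maximal elements with one another. Then: (i) if $n$ is odd, there is an integer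 $k\ge 1$ such that $P$ is isomorphic to $\boxplus^k(B_n)$; (ii) if $n$ is even, $P$ is isomorphic to $B_n$. -/

import Mathlib

namespace ShefferPoset

/-! Throughout, a finite poset with least element `⊥` and greatest element `⊤` all of whose intervals
are graded is encoded by `[PartialOrder P] [BoundedOrder P] [Finite P] [GradeMinOrder ℕ P]`. The rank
function is `grade ℕ : P → ℕ` (strictly monotone, increasing by exactly one along each covering
relation, and zero at `⊥`), and the rank of `P` is `grade ℕ (⊤ : P)`. -/

section Graded

variable (P : Type*) [PartialOrder P] [GradeMinOrder ℕ P]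

/-- Euler-Poincaré relation on every interval with more than one element: as many elements of even
rank as of odd rank. -/
def IsEulerian : Prop :=
  ∀ x y : P, x < y →
    {z : P | z ∈ Set.Icc x y ∧ Even (grade ℕ z)}.ncard =
      {z : P | z ∈ Set.Icc x y ∧ Odd (grade ℕ z)}.ncard

variable {P}

/-- `[x, y]` is an `n`-interval: `x ≤ y`, and the ranks of `x` and `y` differ by `n`. -/
def IsNInterval (n : ℕ) (x y : P) : Prop :=
  x ≤ y ∧ grade ℕ y = grade ℕ x + n

/-- The number of maximal chains of the interval `[x, y]`. -/
noncomputable def numMaxChains {P : Type*} [PartialOrder P] (x y : P) : ℕ :=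
  Nat.card (Flag (Set.Icc x y))

variable (P) [BoundedOrder P]

/-- Sheffer posets: for each `n`, any two `n`-intervals starting at the least element have the same
number of maximal chains, and so do any two `n`-intervals not starting at the least element. -/
structure IsSheffer : Prop where
  sheffer_intervals : ∀ (n : ℕ) (y v : P),
    IsNInterval n ⊥ y → IsNInterval n ⊥ v → numMaxChains ⊥ y = numMaxChains ⊥ v
  binomial_intervals : ∀ (n : ℕ) (x y u v : P), x ≠ ⊥ → u ≠ ⊥ →
    IsNInterval n x y → IsNInterval n u v → numMaxChains x y = numMaxChains u v

/-- `D` is the Sheffer factorial function of `P`: each `n`-interval `[⊥, y]` has `D n` maximal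
chains. -/
def IsShefferFactorial (D : ℕ → ℕ) : Prop :=
  ∀ (n : ℕ) (y : P), IsNInterval n ⊥ y → numMaxChains ⊥ y = D n

/-- `B` is the binomial factorial function of `P`: each `n`-interval `[x, y]` with `x ≠ ⊥` has `B n`
maximal chains. -/
def IsBinomialFactorial (B : ℕ → ℕ) : Prop :=
  ∀ (n : ℕ) (x y : P), x ≠ ⊥ → IsNInterval n x y → numMaxChains x y = B n

end Graded

/-- The boolean lattice of rank `n`: the subsets of an `n`-element set, ordered by inclusion. -/
abbrev BooleanLattice (n : ℕ) : Type := Finset (Fin n)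

/-- The disjoint union of `k` copies of `P`; `⟨i, x⟩` is the element `x` of the `i`-th copy. -/
structure Copies (k : ℕ) (P : Type*) where
  idx : Fin k
  val : P

/-- The preorder on `k` copies of `P` in which, besides the relations inside each copy, every copy of
`⊥` is below everything and every copy of `⊤` is above everything. -/
instance Copies.instPreorder (k : ℕ) (P : Type*) [PartialOrder P] [BoundedOrder P] :
    Preorder (Copies k P) where
  le a b := a.val = ⊥ ∨ b.val = ⊤ ∨ (a.idx = b.idx ∧ a.val ≤ b.val)
  le_refl a := Or.inr (Or.inr ⟨rfl, le_rfl⟩)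
  le_trans a b c hab hbc := by
    rcases hab with h | h | ⟨h1, h2⟩
    · exact Or.inl h
    · rcases hbc with h' | h' | ⟨_, h2'⟩
      · left
        have hbt : (⊥ : P) = ⊤ := h'.symm.trans h
        exact le_bot_iff.mp (hbt ▸ le_top)
      · exact Or.inr (Or.inl h')
      · exact Or.inr (Or.inl (top_le_iff.mp (h ▸ h2')))
    · rcases hbc with h' | h' | ⟨h1', h2'⟩
      · exact Or.inl (le_bot_iff.mp (h' ▸ h2))
      · exact Or.inr (Or.inl h')
      · exact Or.inr (Or.inr ⟨h1.trans h1', h2.trans h2'⟩)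

/-- The `k`-summation of `P`: `k` copies of `P` with all the least elements identified and all the
greatest elements identified. -/
abbrev KSummation (k : ℕ) (P : Type*) [PartialOrder P] [BoundedOrder P] : Type _ :=
  Antisymmetrization (Copies k P) (· ≤ ·)

end ShefferPoset

/-! Let every interval of rank at most `m` be boolean, and let `[x, y]` have rank `m + 1 > 3`. Call
two atoms of `[x, y]` linked if they have a common upper bound other than `y`. Since the intervals
`[b, y]` above the atoms `b` are boolean, this is an equivalence relation with classes of size
`m + 1`, and the elements of `[x, y]` other than `y` are the proper subsets of the classes, the
empty subsets being identified. So `[x, y]` is a summation of `k` boolean lattices, where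
`k (m + 1)` is its number of atoms.

If `m` is even and `[x, y]` has rank `m + 2`, its subintervals of rank `m + 1` are such summations.
Counting maximal chains, the Sheffer condition shows that all those ending at `y` have the same
number of summands, and so do all those starting at `x`. By double counting, the level sizes of
`[x, y]` in ranks `2, …, m` are therefore a common multiple of those of a boolean lattice, and the
Euler relation then forces both numbers of summands to be `1` and `[x, y]` to have `m + 2` atoms.
Then each coatom of `[x, y]` misses exactly one atom, which makes `[x, y]` boolean as well.

Hence all intervals of even rank are boolean, and only the whole poset, when its rank is odd, can be
a nontrivial summation. -/

namespace ShefferPoset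

open Set

section Chains

variable {P : Type*} [PartialOrder P] {x y a : P} {s : Set P}

/-- `s` is a maximal chain of the interval `[x, y]`, viewed as a set of elements of the ambient
poset: the elements of `s` are exactly the elements of `[x, y]` comparable with all of `s`. -/
def IsMaxChainIn (x y : P) (s : Set P) : Prop :=
  ∀ w, w ∈ s ↔ w ∈ Icc x y ∧ ∀ b ∈ s, w ≤ b ∨ b ≤ w

namespace IsMaxChainIn

theorem subset_Icc (h : IsMaxChainIn x y s) : s ⊆ Icc x y := fun w hw => ((h w).1 hw).1

theorem le_or_le (h : IsMaxChainIn x y s) {b c : P} (hb : b ∈ s) (hc : c ∈ s) : b ≤ c ∨ c ≤ b :=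
  ((h b).1 hb).2 c hc

theorem left_mem (h : IsMaxChainIn x y s) (hxy : x ≤ y) : x ∈ s :=
  (h x).2 ⟨left_mem_Icc.2 hxy, fun _ hb => Or.inl (h.subset_Icc hb).1⟩

theorem image_val (F : Flag (Icc x y)) : IsMaxChainIn x y (Subtype.val '' (F : Set (Icc x y))) := by
  intro w
  constructor
  · rintro ⟨w, hw, rfl⟩
    exact ⟨w.2, forall_mem_image.2 fun b hb => F.le_or_le hw hb⟩
  · rintro ⟨hw, h⟩
    exact ⟨⟨w, hw⟩, Flag.mem_iff_forall_le_or_ge.2 fun b hb => h b ⟨b, hb, rfl⟩, rfl⟩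

theorem exists_flag (h : IsMaxChainIn x y s) :
    ∃ F : Flag (Icc x y), Subtype.val '' (F : Set (Icc x y)) = s := by
  refine ⟨⟨Subtype.val ⁻¹' s, fun b hb c hc _ => h.le_or_le hb hc, fun t ht hst => ?_⟩, ?_⟩
  · refine hst.antisymm fun w hw => (h w).2 ⟨w.2, fun b hb => ?_⟩
    exact ht.total hw (hst (a := ⟨b, h.subset_Icc hb⟩) hb)
  · exact Subtype.image_preimage_coe .. |>.trans (inter_eq_right.2 h.subset_Icc)

theorem insert (h : IsMaxChainIn a y s) (hxa : x ⋖ a) (hay : a ≤ y) :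
    IsMaxChainIn x y (insert x s) := by
  intro w
  simp only [mem_insert_iff, forall_eq_or_imp]
  constructor
  · rintro (rfl | hw)
    · exact ⟨⟨le_rfl, hxa.le.trans hay⟩, Or.inl le_rfl,
        fun b hb => Or.inl (hxa.le.trans (h.subset_Icc hb).1)⟩
    · have haw := (h.subset_Icc hw).1
      exact ⟨⟨hxa.le.trans haw, (h.subset_Icc hw).2⟩, Or.inr (hxa.le.trans haw),
        fun b hb => h.le_or_le hw hb⟩
  · rintro ⟨hw, -, hws⟩
    rcases hws a (h.left_mem hay) with hwa | haw
    · exact (hxa.eq_or_eq hw.1 hwa).imp_right fun heq => mem_of_eq_of_mem heq (h.left_mem hay)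
    · exact Or.inr ((h w).2 ⟨⟨haw, hw.2⟩, hws⟩)

theorem sdiff_singleton (h : IsMaxChainIn x y s) (hxa : x < a)
    (hmin : ∀ b ∈ s, b ≠ x → a ≤ b) : IsMaxChainIn a y (s \ {x}) := by
  intro w
  refine ⟨fun hw => ⟨⟨hmin w hw.1 hw.2, (h.subset_Icc hw.1).2⟩, fun b hb => h.le_or_le hw.1 hb.1⟩,
    fun ⟨hw, hws⟩ => ⟨(h w).2 ⟨⟨hxa.le.trans hw.1, hw.2⟩, fun b hb => ?_⟩, (hxa.trans_le hw.1).ne'⟩⟩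
  by_cases hbx : b = x
  · exact Or.inr (hbx ▸ hxa.le.trans hw.1)
  · exact hws b ⟨hb, hbx⟩

theorem exists_sdiff [Finite P] (h : IsMaxChainIn x y s) (hxy : x < y) :
    ∃ a, x ⋖ a ∧ a ≤ y ∧ IsMaxChainIn a y (s \ {x}) := by
  have hys : y ∈ s := (h y).2 ⟨⟨hxy.le, le_rfl⟩, fun _ hb => Or.inr (h.subset_Icc hb).2⟩
  obtain ⟨a, ⟨has, hax⟩, ha⟩ := (toFinite (s \ {x})).exists_minimal ⟨y, hys, hxy.ne'⟩
  have hmin : ∀ b ∈ s, b ≠ x → a ≤ b := fun b hb hbx =>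
    (h.le_or_le has hb).elim id fun hba => ha ⟨hb, hbx⟩ hba
  have hxa : x < a := lt_of_le_of_ne' (h.subset_Icc has).1 hax
  refine ⟨a, ⟨hxa, fun w hxw hwa => ?_⟩, (h.subset_Icc has).2, h.sdiff_singleton hxa hmin⟩
  refine hwa.not_ge (hmin w ((h w).2 ⟨⟨hxw.le, hwa.le.trans (h.subset_Icc has).2⟩, ?_⟩) hxw.ne')
  intro b hb
  by_cases hbx : b = x
  · exact Or.inr (hbx ▸ hxw.le)
  · exact Or.inl (hwa.le.trans (hmin b hb hbx))

end IsMaxChainIn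

theorem numMaxChains_eq_ncard (x y : P) : numMaxChains x y = {s | IsMaxChainIn x y s}.ncard := by
  have hrange : {s | IsMaxChainIn x y s} =
      range fun F : Flag (Icc x y) => Subtype.val '' (F : Set (Icc x y)) :=
    Subset.antisymm (fun s hs => IsMaxChainIn.exists_flag hs)
      (range_subset_iff.2 fun F => IsMaxChainIn.image_val F)
  rw [hrange, ncard_range_of_injective fun F G h =>
    Flag.ext (Subtype.val_injective.image_injective h)]
  rfl

theorem numMaxChains_self (x : P) : numMaxChains x x = 1 := by
  have : {s | IsMaxChainIn x x s} = {{x}} := by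
    ext s
    constructor
    · intro h
      exact (Icc_self x ▸ h.subset_Icc).antisymm (singleton_subset_iff.2 (h.left_mem le_rfl))
    · rintro rfl w
      simp +contextual
  rw [numMaxChains_eq_ncard, this, ncard_singleton]

theorem numMaxChains_eq_mul [Finite P] (hxy : x < y) {M : ℕ}
    (h : ∀ a, x ⋖ a → a ≤ y → numMaxChains a y = M) :
    numMaxChains x y = {a | x ⋖ a ∧ a ≤ y}.ncard * M := by
  have hbij : Nat.card (Σ a : {a | x ⋖ a ∧ a ≤ y}, {s | IsMaxChainIn a.1 y s}) =
      Nat.card {s | IsMaxChainIn x y s} := by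
    refine Nat.card_eq_of_bijective
      (fun p => ⟨insert x p.2.1, p.2.2.insert p.1.2.1 p.1.2.2⟩) ⟨?_, ?_⟩
    · rintro ⟨⟨a, hxa, hay⟩, s, hs⟩ ⟨⟨b, hxb, hby⟩, t, ht⟩ heq
      have hxs : x ∉ s := fun hx => (hs.subset_Icc hx).1.not_gt hxa.lt
      have hxt : x ∉ t := fun hx => (ht.subset_Icc hx).1.not_gt hxb.lt
      obtain rfl : s = t := by
        rw [← insert_sdiff_self_of_notMem hxs, ← insert_sdiff_self_of_notMem hxt]
        exact congrArg (fun u => u.1 \ {x}) heq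
      obtain rfl : a = b := le_antisymm (hs.subset_Icc (ht.left_mem hby)).1
        (ht.subset_Icc (hs.left_mem hay)).1
      rfl
    · rintro ⟨s, hs⟩
      obtain ⟨a, hxa, hay, hsa⟩ := hs.exists_sdiff hxy
      refine ⟨⟨⟨a, hxa, hay⟩, s \ {x}, hsa⟩, Subtype.ext ?_⟩
      exact insert_sdiff_singleton.trans (insert_eq_of_mem (hs.left_mem hxy.le))
  have := Fintype.ofFinite {a | x ⋖ a ∧ a ≤ y}
  have hfiber (a : {a | x ⋖ a ∧ a ≤ y}) : Nat.card {s | IsMaxChainIn a.1 y s} = M :=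
    (numMaxChains_eq_ncard a.1 y).symm.trans (h a.1 a.2.1 a.2.2)
  rw [numMaxChains_eq_ncard, ← Nat.card_coe_set_eq, ← hbij, Nat.card_sigma]
  simp only [hfiber, Finset.sum_const, Finset.card_univ, smul_eq_mul, ← Nat.card_eq_fintype_card,
    Nat.card_coe_set_eq]

end Chains

section Levels

variable {P : Type*} [PartialOrder P] [GradeMinOrder ℕ P] {x y z w a : P} {i j n : ℕ}

theorem grade_lt_grade (h : z < w) : grade ℕ z < grade ℕ w := grade_strictMono (𝕆 := ℕ) h

theorem grade_le_grade (h : z ≤ w) : grade ℕ z ≤ grade ℕ w := grade_mono (𝕆 := ℕ) h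

theorem eq_of_le_of_grade_le (h : z ≤ w) (hg : grade ℕ w ≤ grade ℕ z) : z = w :=
  eq_of_le_of_not_lt h fun hlt => (grade_lt_grade hlt).not_ge hg

theorem covBy_iff_isNInterval_one : z ⋖ w ↔ IsNInterval 1 z w := by
  rw [covBy_iff_lt_covBy_grade (𝕆 := ℕ), Nat.covBy_iff_add_one_eq, eq_comm]
  refine ⟨fun h => ⟨h.1.le, h.2⟩, fun h => ⟨lt_of_le_of_ne h.1 ?_, h.2⟩⟩
  rintro rfl
  exact absurd h.2 (by omega)

namespace IsNInterval

theorem of_le (h : z ≤ w) : IsNInterval (grade ℕ w - grade ℕ z) z w :=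
  ⟨h, by have := grade_le_grade h; omega⟩

theorem lt (h : IsNInterval n z w) (hn : 0 < n) : z < w := by
  refine lt_of_le_of_ne h.1 ?_
  rintro rfl
  exact absurd h.2 (by omega)

theorem pos_of_lt (h : IsNInterval n z w) (hzw : z < w) : 0 < n := by
  have := grade_lt_grade hzw
  have := h.2
  omega

theorem eq_of_zero (h : IsNInterval 0 z w) : z = w := eq_of_le_of_grade_le h.1 h.2.le

theorem trans (hxz : IsNInterval i x z) (hzy : IsNInterval j z y) : IsNInterval (i + j) x y :=
  ⟨hxz.1.trans hzy.1, by rw [hzy.2, hxz.2, add_assoc]⟩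

theorem right_of_add (h : IsNInterval (i + j) x y) (hxz : IsNInterval i x z) (hzy : z ≤ y) :
    IsNInterval j z y :=
  ⟨hzy, by rw [h.2, hxz.2, add_assoc]⟩

theorem left_of_add (h : IsNInterval (i + j) x y) (hxz : x ≤ z) (hzy : IsNInterval j z y) :
    IsNInterval i x z :=
  ⟨hxz, by have := h.2; have := hzy.2; omega⟩

end IsNInterval

/-- The elements of rank `i` of the interval `[x, y]`, ranks being counted from `x`. -/
def level (x y : P) (i : ℕ) : Set P := {z | IsNInterval i x z ∧ z ≤ y}

theorem mem_level : z ∈ level x y i ↔ IsNInterval i x z ∧ z ≤ y := Iff.rfl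

theorem mem_level_one : a ∈ level x y 1 ↔ x ⋖ a ∧ a ≤ y := by
  rw [mem_level, covBy_iff_isNInterval_one]

theorem level_subset_Icc : level x y i ⊆ Icc x y := fun _ hz => ⟨hz.1.1, hz.2⟩

theorem level_mono_right (h : y ≤ z) : level x y i ⊆ level x z i := fun _ hw => ⟨hw.1, hw.2.trans h⟩

theorem level_zero (hxy : x ≤ y) : level x y 0 = {x} := by
  ext z
  refine ⟨fun hz => hz.1.eq_of_zero.symm, ?_⟩
  rintro rfl
  exact ⟨⟨le_rfl, rfl⟩, hxy⟩

theorem IsNInterval.level_self (h : IsNInterval n x y) : level x y n = {y} := by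
  ext z
  refine ⟨fun hz => eq_of_le_of_grade_le hz.2 (by rw [hz.1.2, h.2]), ?_⟩
  rintro rfl
  exact ⟨h, le_rfl⟩

theorem level_one_self : level x x 1 = ∅ :=
  eq_empty_of_forall_notMem fun _ ha => (ha.1.lt one_pos).not_ge ha.2

theorem level_one_nonempty (h : x < y) : (level x y 1).Nonempty :=
  (exists_covBy_le_of_lt h).imp fun _ ha => mem_level_one.2 ha

theorem IsEulerian.sum_neg_one_pow_grade [Fintype P] [DecidableRel (α := P) (· ≤ ·)]
    (hE : IsEulerian P) (hxy : x < y) :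
    ∑ z with x ≤ z ∧ z ≤ y, (-1 : ℤ) ^ grade ℕ z = 0 := by
  have hcard := hE x y hxy
  simp only [ncard_eq_toFinset_card', toFinset_ofPred, mem_Icc] at hcard
  simp [neg_one_pow_eq_ite, Finset.sum_ite, Finset.filter_filter, hcard]

section Finite

variable [Finite P]

theorem ncard_level_mul_ncard_level {p q : ℕ}
    (hp : ∀ z ∈ level x y i, (level z y j).ncard = p)
    (hq : ∀ w ∈ level x y (i + j), (level x w i).ncard = q) :
    (level x y i).ncard * p = (level x y (i + j)).ncard * q := by
  classical
  have := Fintype.ofFinite P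
  simp only [ncard_eq_toFinset_card'] at hp hq ⊢
  refine Finset.card_mul_eq_card_mul (· ≤ ·) (fun z hz => ?_) fun w hw => ?_
  · rw [mem_toFinset] at hz
    rw [← hp z hz]
    congr 1
    ext w
    simp only [Finset.mem_bipartiteAbove, mem_toFinset, mem_level]
    exact ⟨fun hw => ⟨hw.1.1.right_of_add hz.1 hw.2, hw.1.2⟩,
      fun hw => ⟨⟨hz.1.trans hw.1, hw.2⟩, hw.1.1⟩⟩
  · rw [mem_toFinset] at hw
    rw [← hq w hw]
    congr 1
    ext z
    simp only [Finset.mem_bipartiteBelow, mem_toFinset, mem_level]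
    exact ⟨fun hz => ⟨hz.1.1, hz.2⟩, fun hz => ⟨⟨hz.1, hz.2.trans hw.2⟩, hz.2⟩⟩

theorem numMaxChains_eq_ncard_level_one_mul (hxy : x < y) {M : ℕ}
    (h : ∀ a ∈ level x y 1, numMaxChains a y = M) :
    numMaxChains x y = (level x y 1).ncard * M := by
  rw [numMaxChains_eq_mul hxy fun a hxa hay => h a (mem_level_one.2 ⟨hxa, hay⟩)]
  congr 2
  exact Set.ext fun a => mem_level_one.symm

theorem IsEulerian.sum_neg_one_pow_mul_ncard_level (hE : IsEulerian P) (h : IsNInterval n x y)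
    (hn : 0 < n) : ∑ i ∈ Finset.range (n + 1), (-1 : ℤ) ^ i * (level x y i).ncard = 0 := by
  classical
  have := Fintype.ofFinite P
  have hzero := hE.sum_neg_one_pow_grade (h.lt hn)
  rw [← Finset.sum_fiberwise_of_maps_to (t := Finset.range (n + 1))
    (g := fun z => grade ℕ z - grade ℕ x) fun z hz => ?_] at hzero
  · have hfiber (i : ℕ) : ∑ z with (x ≤ z ∧ z ≤ y) ∧ grade ℕ z - grade ℕ x = i,
        (-1 : ℤ) ^ grade ℕ z = (-1) ^ grade ℕ x * ((-1) ^ i * (level x y i).ncard) := by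
      have hmem (z : P) : (x ≤ z ∧ z ≤ y) ∧ grade ℕ z - grade ℕ x = i ↔ z ∈ level x y i := by
        refine ⟨fun ⟨⟨hxz, hzy⟩, hi⟩ => ⟨hi ▸ IsNInterval.of_le hxz, hzy⟩,
          fun hz => ⟨⟨hz.1.1, hz.2⟩, ?_⟩⟩
        rw [hz.1.2, Nat.add_sub_cancel_left]
      simp only [hmem]
      rw [Finset.sum_congr rfl (g := fun _ => (-1 : ℤ) ^ (grade ℕ x + i)) fun z hz => by
        rw [(Finset.mem_filter.1 hz).2.1.2], Finset.sum_const, nsmul_eq_mul,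
        ncard_eq_toFinset_card', pow_add, ← filter_mem_univ_eq_toFinset]
      ring
    simp only [Finset.filter_filter, hfiber, ← Finset.mul_sum] at hzero
    exact (mul_eq_zero.1 hzero).resolve_left (pow_ne_zero _ (by norm_num))
  · have := grade_le_grade (Finset.mem_filter.1 hz).2.2
    have := h.2
    rw [Finset.mem_range]
    omega

end Finite

end Levels

section BooleanIntervals

/-- `[x, y]` is isomorphic to the boolean lattice of rank `m`. -/
def IsBooleanInterval {P : Type*} [PartialOrder P] (m : ℕ) (x y : P) : Prop :=
  Nonempty (Icc x y ≃o BooleanLattice m)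

variable {P : Type*} [PartialOrder P] {x y z w : P} {i m n : ℕ}

theorem symm_singleton_le_iff (e : Icc x y ≃o BooleanLattice m) {j : Fin m} (z : Icc x y) :
    (e.symm {j} : P) ≤ z ↔ j ∈ e z := by
  rw [Subtype.coe_le_coe, e.symm_apply_le, Finset.singleton_subset_iff]

variable [GradeMinOrder ℕ P]

theorem grade_symm_apply (e : Icc x y ≃o BooleanLattice m) (S : BooleanLattice m) :
    grade ℕ (e.symm S : P) = grade ℕ x + S.card := by
  induction S using Finset.induction_on with
  | empty =>
    have hxy : x ≤ y := (e.symm ∅).2.1.trans (e.symm ∅).2.2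
    have hle : e.symm ∅ ≤ ⟨x, left_mem_Icc.2 hxy⟩ := (e.symm_apply_le).2 (Finset.empty_subset _)
    rw [Finset.card_empty, add_zero, le_antisymm hle (e.symm ∅).2.1]
  | insert a S ha ih =>
    have hcov : e.symm S ⋖ e.symm (insert a S) :=
      (apply_covBy_apply_iff e.symm).2 (Finset.covBy_insert ha)
    have hcov' : (e.symm S : P) ⋖ e.symm (insert a S) := by
      refine (OrdConnected.apply_covBy_apply_iff (OrderEmbedding.subtype (· ∈ Icc x y)) ?_).2 hcov
      exact (Subtype.range_coe (s := Icc x y)).symm ▸ ordConnected_Icc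
    rw [(covBy_iff_isNInterval_one.1 hcov').2, ih, Finset.card_insert_of_notMem ha, add_assoc]

theorem symm_apply_mem_level (e : Icc x y ≃o BooleanLattice m) {S : BooleanLattice m} :
    (e.symm S : P) ∈ level x y i ↔ S.card = i := by
  simp only [mem_level, IsNInterval, grade_symm_apply, add_right_inj, and_iff_left (e.symm S).2.2,
    and_iff_right (e.symm S).2.1]

theorem mem_level_one_iff_exists_singleton (e : Icc x y ≃o BooleanLattice m) {a : P} :
    a ∈ level x y 1 ↔ ∃ j, (e.symm {j} : P) = a := by
  refine ⟨fun ha => ?_, ?_⟩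
  · lift a to Icc x y using level_subset_Icc ha
    rw [← e.symm_apply_apply a, symm_apply_mem_level, Finset.card_eq_one] at ha
    obtain ⟨j, hj⟩ := ha
    exact ⟨j, by rw [← hj, e.symm_apply_apply]⟩
  · rintro ⟨j, rfl⟩
    exact (symm_apply_mem_level e).2 (Finset.card_singleton j)

theorem isBooleanInterval_of_level_one [Finite P] (hn : (level x y 1).ncard = n)
    (hle : ∀ z ∈ Icc x y, ∀ w ∈ Icc x y, level x z 1 ⊆ level x w 1 → z ≤ w)
    (hex : ∀ T ⊆ level x y 1, ∃ z ∈ Icc x y, level x z 1 = T) : IsBooleanInterval n x y := by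
  classical
  let e : level x y 1 ≃ Fin n := Finite.equivFinOfCardEq hn
  let φ (z : Icc x y) : BooleanLattice n := Finset.univ.filter fun j => (e.symm j : P) ≤ z
  have hφ (z w : Icc x y) : φ z ≤ φ w ↔ z ≤ w := by
    refine ⟨fun h => hle z z.2 w w.2 fun a ha => ⟨ha.1, ?_⟩,
      fun h => Finset.monotone_filter_right _ fun j _ (hj : (e.symm j : P) ≤ z) => hj.trans h⟩
    have := @h (e ⟨a, ha.1, ha.2.trans z.2.2⟩)
    simpa [φ, ha.2] using this
  refine ⟨RelIso.ofSurjective (OrderEmbedding.ofMapLEIff φ hφ) fun S => ?_⟩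
  obtain ⟨z, hz, hzS⟩ := hex ((fun j => (e.symm j : P)) '' S)
    (image_subset_iff.2 fun j _ => (e.symm j).2)
  refine ⟨⟨z, hz⟩, Finset.ext fun j => ?_⟩
  have hj : (e.symm j : P) ≤ z ↔ (e.symm j : P) ∈ level x z 1 :=
    (and_iff_right (e.symm j).2.1).symm
  simp [φ, hj, hzS, Subtype.val_inj]

namespace IsBooleanInterval

theorem le_of_level_one_subset (h : IsBooleanInterval m x y) (hz : z ∈ Icc x y) (hw : w ∈ Icc x y)
    (hzw : level x z 1 ⊆ level x w 1) : z ≤ w := by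
  obtain ⟨e⟩ := h
  lift z to Icc x y using hz
  lift w to Icc x y using hw
  refine e.le_iff_le.1 fun j hj => ?_
  rw [← symm_singleton_le_iff] at hj ⊢
  exact (hzw ⟨((mem_level_one_iff_exists_singleton e).2 ⟨j, rfl⟩).1, hj⟩).2

theorem exists_level_one_eq (h : IsBooleanInterval m x y) {T : Set P} (hT : T ⊆ level x y 1) :
    ∃ z ∈ Icc x y, level x z 1 = T := by
  classical
  obtain ⟨e⟩ := h
  refine ⟨e.symm (Finset.univ.filter fun j => (e.symm {j} : P) ∈ T), (e.symm _).2,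
    Subset.antisymm (fun a ha => ?_) fun a ha => ?_⟩
  · obtain ⟨j, rfl⟩ := (mem_level_one_iff_exists_singleton e).1
      (level_mono_right (e.symm _).2.2 ha)
    simpa [symm_singleton_le_iff] using ha.2
  · refine ⟨(hT ha).1, ?_⟩
    obtain ⟨j, rfl⟩ := (mem_level_one_iff_exists_singleton e).1 (hT ha)
    simpa [symm_singleton_le_iff] using ha

theorem ncard_level (h : IsBooleanInterval m x y) (i : ℕ) :
    (level x y i).ncard = m.choose i := by
  obtain ⟨e⟩ := h
  have himage : level x y i =
      (fun S => (e.symm S : P)) '' (Finset.univ.powersetCard i : Finset (BooleanLattice m)) := by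
    ext z
    simp only [mem_image, Finset.mem_coe, Finset.mem_powersetCard_univ]
    constructor
    · intro hz
      lift z to Icc x y using level_subset_Icc hz
      exact ⟨e z, by rwa [← symm_apply_mem_level e, e.symm_apply_apply], by rw [e.symm_apply_apply]⟩
    · rintro ⟨S, hS, rfl⟩
      exact (symm_apply_mem_level e).2 hS
  have hinj : (fun S => (e.symm S : P)).Injective := Subtype.val_injective.comp e.symm.injective
  rw [himage, ncard_image_of_injective _ hinj, ncard_coe_finset, Finset.card_powersetCard,
    Finset.card_univ, Fintype.card_fin]

end IsBooleanInterval

variable (P) in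
/-- Every interval of rank at most `m` is boolean; this is the induction hypothesis of the
classification. -/
def BooleanUpTo (m : ℕ) : Prop :=
  ∀ k ≤ m, ∀ x y : P, IsNInterval k x y → IsBooleanInterval k x y

namespace BooleanUpTo

theorem mono (h : BooleanUpTo P n) (hmn : m ≤ n) : BooleanUpTo P m :=
  fun k hk => h k (hk.trans hmn)

theorem succ (h : BooleanUpTo P m)
    (hsucc : ∀ x y : P, IsNInterval (m + 1) x y → IsBooleanInterval (m + 1) x y) :
    BooleanUpTo P (m + 1) := fun k hk => by
  rcases hk.lt_or_eq with hlt | rfl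
  exacts [h k (Nat.lt_succ_iff.1 hlt), hsucc]

theorem isBooleanInterval_of_lt_right (h : BooleanUpTo P m) (hxy : IsNInterval (m + 1) x y)
    (hxz : x ≤ z) (hzy : z < y) : IsBooleanInterval (grade ℕ z - grade ℕ x) x z := by
  refine h _ ?_ x z (.of_le hxz)
  have := grade_lt_grade hzy
  have := hxy.2
  omega

theorem ncard_level_of_isNInterval (h : BooleanUpTo P m) (hxy : IsNInterval n x y) (hn : n ≤ m)
    (i : ℕ) : (level x y i).ncard = n.choose i :=
  (h n hn x y hxy).ncard_level i

theorem numMaxChains_eq_factorial [Finite P] (h : BooleanUpTo P m) (hxy : IsNInterval m x y) :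
    numMaxChains x y = m.factorial := by
  induction m generalizing x with
  | zero => rw [hxy.eq_of_zero, numMaxChains_self, Nat.factorial_zero]
  | succ m ih =>
    rw [numMaxChains_eq_ncard_level_one_mul (hxy.lt m.succ_pos) fun a ha =>
      ih (h.mono m.le_succ) ((Nat.add_comm m 1 ▸ hxy).right_of_add ha.1 ha.2),
      h.ncard_level_of_isNInterval hxy le_rfl, Nat.choose_one_right, Nat.factorial_succ]

theorem numMaxChains_eq_mul_factorial [Finite P] (h : BooleanUpTo P m)
    (hxy : IsNInterval (m + 1) x y) :
    numMaxChains x y = (level x y 1).ncard * m.factorial :=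
  numMaxChains_eq_ncard_level_one_mul (hxy.lt m.succ_pos) fun _ ha =>
    h.numMaxChains_eq_factorial ((Nat.add_comm m 1 ▸ hxy).right_of_add ha.1 ha.2)

end BooleanUpTo

end BooleanIntervals

section Criterion

variable {P : Type*} [PartialOrder P] [GradeMinOrder ℕ P] [Finite P] {x y z w c : P} {i k m : ℕ}

namespace BooleanUpTo

theorem ncard_level_one_mul_choose (hP : BooleanUpTo P m) (hxy : IsNInterval (m + 1) x y)
    (hi : i < m) :
    (level x y 1).ncard * m.choose i = (level x y (i + 1)).ncard * (i + 1) := by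
  rw [Nat.add_comm m 1] at hxy
  rw [Nat.add_comm i 1]
  refine ncard_level_mul_ncard_level (fun a ha => ?_) fun w hw => ?_
  · exact hP.ncard_level_of_isNInterval (hxy.right_of_add ha.1 ha.2) le_rfl i
  · rw [hP.ncard_level_of_isNInterval hw.1 (by omega), Nat.choose_one_right]

theorem ncard_level_eq_mul_choose (hP : BooleanUpTo P m) (hxy : IsNInterval (m + 1) x y)
    (hk : (level x y 1).ncard = k * (m + 1)) (hi : 0 < i) (him : i ≤ m) :
    (level x y i).ncard = k * (m + 1).choose i := by
  obtain ⟨i, rfl⟩ := Nat.exists_eq_succ_of_ne_zero hi.ne'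
  refine Nat.eq_of_mul_eq_mul_right hi ?_
  rw [mul_assoc, ← Nat.add_one_mul_choose_eq, ← mul_assoc, ← hk,
    ncard_level_one_mul_choose hP hxy him]

theorem eq_of_not_le_coatom (hP : BooleanUpTo P m)
    (hatoms : (level x y 1).ncard = m + 1) {p q : P} (hc : c ∈ level x y m)
    (hp : p ∈ level x y 1) (hq : q ∈ level x y 1) (hpc : ¬ p ≤ c) (hqc : ¬ q ≤ c) : p = q := by
  have hdiff : (level x y 1 \ level x c 1).ncard = 1 := by
    rw [ncard_sdiff (level_mono_right hc.2), hatoms, hP.ncard_level_of_isNInterval hc.1 le_rfl,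
      Nat.choose_one_right, Nat.add_sub_cancel_left]
  exact (ncard_le_one (toFinite _)).1 hdiff.le p ⟨hp, fun h => hpc h.2⟩ q ⟨hq, fun h => hqc h.2⟩

section

variable (hP : BooleanUpTo P m) (hxy : IsNInterval (m + 1) x y)
  (hatoms : (level x y 1).ncard = m + 1)
include hP hxy hatoms

theorem ncard_coatoms_not_ge (hz : IsNInterval i x z) (hi : 0 < i) (hzy : z < y) :
    (level x y m \ Ici z).ncard = i := by
  obtain ⟨j, rfl⟩ : ∃ j, m = i + j := Nat.exists_eq_add_of_le <| by
    have := grade_lt_grade hzy; have := hz.2; have := hxy.2; omega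
  have hzy' : IsNInterval (j + 1) z y := (add_assoc i j 1 ▸ hxy).right_of_add hz hzy.le
  have habove : level x y (i + j) ∩ Ici z = level z y j := by
    ext c
    exact ⟨fun hc => ⟨hc.1.1.right_of_add hz hc.2, hc.1.2⟩,
      fun hc => ⟨⟨hz.trans hc.1, hc.2⟩, hc.1.1⟩⟩
  have hcoatoms := hP.ncard_level_eq_mul_choose hxy (k := 1) (by rw [one_mul, hatoms])
    (hi.trans_le (i.le_add_right j)) le_rfl
  have hcard := ncard_inter_add_ncard_sdiff_eq_ncard (level x y (i + j)) (Ici z)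
  rw [habove, hP.ncard_level_of_isNInterval hzy' (by omega), hcoatoms, one_mul,
    Nat.choose_succ_self_right, Nat.choose_succ_self_right] at hcard
  omega

theorem le_coatom_of_level_one_subset (hc : c ∈ level x y m) (hxz : x ≤ z) (hzy : z < y)
    (hzc : level x z 1 ⊆ level x c 1) : z ≤ c := by
  rcases hxz.eq_or_lt with rfl | hlt
  · exact hc.1.1
  by_contra hnot
  have hpos := (IsNInterval.of_le hxz).pos_of_lt hlt
  have hmissed (p : P) (hp : p ∈ level x z 1) : ∃ d ∈ level x y m, ¬ p ≤ d :=
    nonempty_of_ncard_ne_zero (s := level x y m \ Ici p) <| by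
      rw [ncard_coatoms_not_ge hP hxy hatoms hp.1 one_pos (hp.2.trans_lt hzy)]
      exact one_ne_zero
  choose missed hmem hmissed using hmissed
  -- A coatom misses only one atom, so `missed` injects the atoms below `z` into the coatoms not
  -- above `z`, of which there are equally many; hence some atom below `z` misses `c`.
  have hcard : (level x y m \ Ici z).ncard ≤ (level x z 1).ncard := by
    rw [ncard_coatoms_not_ge hP hxy hatoms (.of_le hxz) hpos hzy,
      (hP.isBooleanInterval_of_lt_right hxy hxz hzy).ncard_level, Nat.choose_one_right]
  have hmaps (p : P) (hp : p ∈ level x z 1) : missed p hp ∈ level x y m \ Ici z :=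
    ⟨hmem p hp, fun hz => hmissed p hp (hp.2.trans hz)⟩
  have hinj (p q : P) (hp : p ∈ level x z 1) (hq : q ∈ level x z 1)
      (heq : missed p hp = missed q hq) : p = q :=
    eq_of_not_le_coatom hP hatoms (hmem p hp) (level_mono_right hzy.le hp)
      (level_mono_right hzy.le hq) (hmissed p hp) (heq ▸ hmissed q hq)
  obtain ⟨p, hp, rfl⟩ := surj_on_of_inj_on_of_ncard_le missed hmaps hinj hcard (toFinite _) c
    ⟨hc, hnot⟩
  exact hmissed p hp (hzc hp).2

theorem le_of_level_one_subset (hxz : x ≤ z) (hzy : z ≤ y) (hw : w ∈ Icc x y)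
    (hzw : level x z 1 ⊆ level x w 1) : z ≤ w := by
  rcases hw.2.eq_or_lt with rfl | hwy
  · exact hzy
  obtain ⟨c, hwc, hcy⟩ := exists_le_covBy_of_lt hwy
  have hc : c ∈ level x y m :=
    ⟨hxy.left_of_add (hw.1.trans hwc) (covBy_iff_isNInterval_one.1 hcy), hcy.le⟩
  have hzc : level x z 1 ⊆ level x c 1 := hzw.trans (level_mono_right hwc)
  have hzne : z ≠ y := by
    rintro rfl
    have := ncard_le_ncard hzc
    rw [hatoms, hP.ncard_level_of_isNInterval hc.1 le_rfl, Nat.choose_one_right] at this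
    omega
  exact (hP m le_rfl x c hc.1).le_of_level_one_subset
    ⟨hxz, le_coatom_of_level_one_subset hP hxy hatoms hc hxz (hzy.lt_of_ne hzne) hzc⟩
    ⟨hw.1, hwc⟩ hzw

theorem exists_level_one_eq {T : Set P} (hT : T ⊆ level x y 1) :
    ∃ z ∈ Icc x y, level x z 1 = T := by
  rcases hT.eq_or_ssubset with rfl | hssub
  · exact ⟨y, right_mem_Icc.2 hxy.1, rfl⟩
  obtain ⟨p, hp, hpT⟩ := exists_of_ssubset hssub
  rcases hp.2.eq_or_lt with rfl | hpy
  · refine ⟨x, left_mem_Icc.2 hxy.1, level_one_self.trans (Eq.symm ?_)⟩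
    exact eq_empty_of_forall_notMem fun q hq => hpT
      (mem_of_eq_of_mem (hp.1.level_self.subset (hT hq)).symm hq)
  obtain ⟨c, hc, hpc⟩ : (level x y m \ Ici p).Nonempty := nonempty_of_ncard_ne_zero <| by
    rw [ncard_coatoms_not_ge hP hxy hatoms hp.1 one_pos hpy]
    exact one_ne_zero
  have hTc : T ⊆ level x c 1 := fun q hq => ⟨(hT hq).1, by
    by_contra hqc
    exact hpT (eq_of_not_le_coatom hP hatoms hc hp (hT hq) hpc hqc ▸ hq)⟩
  obtain ⟨z, hz, hzT⟩ := (hP m le_rfl x c hc.1).exists_level_one_eq hTc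
  exact ⟨z, ⟨hz.1, hz.2.trans hc.2⟩, hzT⟩

theorem isBooleanInterval_of_ncard_level_one : IsBooleanInterval (m + 1) x y :=
  isBooleanInterval_of_level_one hatoms
    (fun _ hz _ hw => le_of_level_one_subset hP hxy hatoms hz.1 hz.2 hw)
    fun _ => exists_level_one_eq hP hxy hatoms

end

end BooleanUpTo

theorem booleanUpTo_zero : BooleanUpTo P 0 := fun k hk x y hxy => by
  obtain rfl := Nat.le_zero.1 hk
  obtain rfl := hxy.eq_of_zero
  refine isBooleanInterval_of_level_one (by rw [level_one_self, ncard_empty])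
    (fun z hz w hw _ => hz.2.trans hw.1) fun T hT => ⟨x, left_mem_Icc.2 le_rfl, ?_⟩
  exact level_one_self.trans (subset_empty_iff.1 (hT.trans_eq level_one_self)).symm

theorem booleanUpTo_one : BooleanUpTo P 1 :=
  have h := booleanUpTo_zero (P := P)
  h.succ fun _ _ hxy =>
    h.isBooleanInterval_of_ncard_level_one hxy (by rw [hxy.level_self, ncard_singleton])

theorem IsEulerian.booleanUpTo_two (hE : IsEulerian P) : BooleanUpTo P 2 := by
  have h := booleanUpTo_one (P := P)
  refine h.succ fun x y hxy => h.isBooleanInterval_of_ncard_level_one hxy ?_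
  have heuler := hE.sum_neg_one_pow_mul_ncard_level hxy two_pos
  simp only [Finset.sum_range_succ, Finset.sum_range_zero, level_zero hxy.1, hxy.level_self,
    ncard_singleton] at heuler
  omega

theorem IsEulerian.booleanUpTo_three (hE : IsEulerian P)
    (h3 : ∀ x y : P, IsNInterval 3 x y → numMaxChains x y = 6) : BooleanUpTo P 3 := by
  have h := hE.booleanUpTo_two
  refine h.succ fun x y hxy => h.isBooleanInterval_of_ncard_level_one hxy ?_
  have hchains := h.numMaxChains_eq_mul_factorial hxy
  rw [h3 x y hxy, Nat.factorial_two] at hchains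
  omega

end Criterion

section KSummation

theorem exists_equiv_fin_prod {α : Type*} [Finite α] {n : ℕ} (s : Setoid α)
    (hs : ∀ a, {b | s a b}.ncard = n) :
    ∃ k, ∃ e : α ≃ Fin k × Fin n, ∀ a b, s a b ↔ (e a).1 = (e b).1 := by
  have hfiber (q : Quotient s) : Nat.card {b // Quotient.mk s b = q} = n := by
    induction q using Quotient.inductionOn with | h a => ?_
    rw [← hs a, ← Nat.card_coe_set_eq]
    exact Nat.card_congr (Equiv.subtypeEquivRight fun b => Quotient.eq.trans s.comm')
  let classes := Finite.equivFin (Quotient s)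
  let e := (Equiv.sigmaFiberEquiv (Quotient.mk s)).symm.trans <|
    (Equiv.sigmaCongrRight fun q => Finite.equivFinOfCardEq (hfiber q)).trans <|
    (Equiv.sigmaEquivProd _ _).trans (classes.prodCongr (Equiv.refl _))
  exact ⟨_, e, fun a b => Quotient.eq.symm.trans classes.injective.eq_iff.symm⟩

theorem nonempty_orderIso_antisymmetrization {α β : Type*} [Preorder α] [PartialOrder β]
    (f : α → β) (hf : ∀ a b, f a ≤ f b ↔ a ≤ b) (hs : f.Surjective) :
    Nonempty (β ≃o Antisymmetrization α (· ≤ ·)) := by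
  have hg (a b : Antisymmetrization α (· ≤ ·)) :
      f (ofAntisymmetrization _ a) ≤ f (ofAntisymmetrization _ b) ↔ a ≤ b :=
    (hf _ _).trans ofAntisymmetrization_le_ofAntisymmetrization_iff
  refine ⟨(RelIso.ofSurjective (OrderEmbedding.ofMapLEIff _ hg) fun b => ?_).symm⟩
  obtain ⟨a, rfl⟩ := hs b
  have hrep : AntisymmRel (· ≤ ·)
      (ofAntisymmetrization (· ≤ ·) (toAntisymmetrization (· ≤ ·) a)) a :=
    Quotient.mk_out (s := AntisymmRel.setoid α (· ≤ ·)) a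
  exact ⟨toAntisymmetrization _ a, le_antisymm ((hf _ _).2 hrep.1) ((hf _ _).2 hrep.2)⟩

theorem nonempty_orderIso_kSummation_one (Q : Type*) [PartialOrder Q] [BoundedOrder Q] :
    Nonempty (Q ≃o KSummation 1 Q) := by
  refine nonempty_orderIso_antisymmetrization (fun a : Copies 1 Q => a.val) (fun a b => ?_)
    fun q => ⟨⟨0, q⟩, rfl⟩
  refine ⟨fun h => Or.inr (Or.inr ⟨Subsingleton.elim _ _, h⟩), ?_⟩
  rintro (h | h | ⟨-, h⟩)
  exacts [h ▸ bot_le, h ▸ le_top, h]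

/-- `a` and `b` have a common upper bound below `y`. On the atoms of an interval `[x, y]` all of
whose proper subintervals are boolean, the classes of this relation are the copies of the boolean
lattice of which `[x, y]` is the summation. -/
def Linked {P : Type*} [Preorder P] (y a b : P) : Prop :=
  ∃ z < y, a ≤ z ∧ b ≤ z

theorem Linked.symm {P : Type*} [Preorder P] {y a b : P} (h : Linked y a b) : Linked y b a :=
  h.imp fun _ h => ⟨h.1, h.2.symm⟩

variable {P : Type*} [PartialOrder P] [GradeMinOrder ℕ P] {x y z w a b c r r' : P} {i k m : ℕ}

theorem IsNInterval.lt_of_mem_level (hxy : IsNInterval m x y) (him : i < m)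
    (ha : a ∈ level x y i) : a < y := by
  refine lt_of_le_of_ne ha.2 ?_
  rintro rfl
  have := ha.1.2
  have := hxy.2
  omega

theorem IsBooleanInterval.exists_lt_of_mem_level_one (h : IsBooleanInterval m x y) (hm : 2 < m)
    (hr : r ∈ level x y 1) (hr' : r' ∈ level x y 1) : ∃ s < y, r ≤ s ∧ r' ≤ s := by
  obtain ⟨s, hs, hsr⟩ := h.exists_level_one_eq (pair_subset hr hr')
  refine ⟨s, lt_of_le_of_ne hs.2 ?_, (hsr.superset (mem_insert r _)).2,
    (hsr.superset (mem_insert_of_mem r rfl)).2⟩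
  rintro rfl
  have hcard := ncard_insert_le r {r'}
  rw [← hsr, h.ncard_level, Nat.choose_one_right, ncard_singleton] at hcard
  omega

namespace BooleanUpTo

theorem isBooleanInterval_of_mem_level_one (hP : BooleanUpTo P m) (hxy : IsNInterval (m + 1) x y)
    (ha : a ∈ level x y 1) : IsBooleanInterval m a y :=
  hP m le_rfl a y ((Nat.add_comm m 1 ▸ hxy).right_of_add ha.1 ha.2)

theorem exists_ne_level_one_eq_pair (hP : BooleanUpTo P m) (hm : 2 ≤ m) (ha : a ∈ level x y 1)
    (hr : r ∈ level a y 1) : ∃ b ∈ level x y 1, a ≠ b ∧ level x r 1 = {a, b} := by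
  have hcard := hP.ncard_level_of_isNInterval (ha.1.trans hr.1) hm 1
  obtain ⟨b, c, hbc, hrbc⟩ := ncard_eq_two.1 hcard
  have har : a ∈ ({b, c} : Set P) := hrbc ▸ ⟨ha.1, hr.1.1⟩
  have hsub : level x r 1 ⊆ level x y 1 := level_mono_right hr.2
  rw [hrbc, pair_subset_iff] at hsub
  rcases har with rfl | rfl
  exacts [⟨c, hsub.2, hbc, hrbc⟩, ⟨b, hsub.1, hbc.symm, hrbc.trans (pair_comm _ _)⟩]

section

variable (hP : BooleanUpTo P m) (hxy : IsNInterval (m + 1) x y)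
include hP hxy

theorem exists_level_one_eq_pair (hzy : z < y) (ha : a ∈ level x z 1) (hb : b ∈ level x z 1)
    (hab : a ≠ b) : ∃ r ∈ level a z 1, level x r 1 = {a, b} := by
  have hxz := (level_subset_Icc ha).1.trans ha.2
  obtain ⟨r, hr, hrab⟩ :=
    (hP.isBooleanInterval_of_lt_right hxy hxz hzy).exists_level_one_eq (pair_subset ha hb)
  have hcard := (hP.isBooleanInterval_of_lt_right hxy hr.1 (hr.2.trans_lt hzy)).ncard_level 1
  rw [hrab, ncard_pair hab, Nat.choose_one_right] at hcard
  have hxr : IsNInterval 2 x r := by rw [hcard]; exact .of_le hr.1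
  exact ⟨r, ⟨(hxr : IsNInterval (1 + 1) x r).right_of_add ha.1
    (hrab.superset (mem_insert a _)).2, hr.2⟩, hrab⟩

theorem exists_level_one_eq_pair_of_linked (ha : a ∈ level x y 1) (hb : b ∈ level x y 1)
    (h : Linked y a b) (hab : a ≠ b) : ∃ r ∈ level a y 1, level x r 1 = {a, b} := by
  obtain ⟨z, hzy, haz, hbz⟩ := h
  obtain ⟨r, hr, hrab⟩ := hP.exists_level_one_eq_pair hxy hzy ⟨ha.1, haz⟩ ⟨hb.1, hbz⟩ hab
  exact ⟨r, level_mono_right hzy.le hr, hrab⟩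

theorem le_of_level_one_subset_of_lt (hm : 2 < m) (hxz : x ≤ z) (hzy : z < y) (hw : w ∈ Icc x y)
    (hzw : level x z 1 ⊆ level x w 1) : z ≤ w := by
  rcases hw.2.eq_or_lt with rfl | hwy
  · exact hzy.le
  rcases hxz.eq_or_lt with rfl | hlt
  · exact hw.1
  obtain ⟨a, ha⟩ := level_one_nonempty hlt
  have hay := hP.isBooleanInterval_of_mem_level_one hxy (level_mono_right hzy.le ha)
  refine hay.le_of_level_one_subset ⟨ha.2, hzy.le⟩ ⟨(hzw ha).2, hw.2⟩ fun r hr => ⟨hr.1, ?_⟩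
  obtain ⟨b, hb, hab, hrab⟩ := hP.exists_ne_level_one_eq_pair (by omega) ha hr
  -- The rank two elements `r ≤ z` and `r' ≤ w` have the same atoms, and they agree because both lie
  -- in some boolean interval `[x, s]`.
  obtain ⟨r', hr', hrab'⟩ := hP.exists_level_one_eq_pair hxy hwy (hzw ha) (hzw hb) hab
  obtain ⟨s, hsy, hrs, hrs'⟩ := hay.exists_lt_of_mem_level_one hm (level_mono_right hzy.le hr)
    (level_mono_right hw.2 hr')
  have hxr := ha.1.1.trans hr.1.1
  have hxs := hP.isBooleanInterval_of_lt_right hxy (hxr.trans hrs) hsy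
  have hrr' : r ≤ r' := hxs.le_of_level_one_subset ⟨hxr, hrs⟩ ⟨ha.1.1.trans hr'.1.1, hrs'⟩
    (hrab.trans hrab'.symm).subset
  exact hrr'.trans hr'.2

theorem linked_trans (hm : 2 < m) (ha : a ∈ level x y 1) (hb : b ∈ level x y 1)
    (hc : c ∈ level x y 1) (hab : Linked y a b) (hbc : Linked y b c) : Linked y a c := by
  rcases eq_or_ne b a with rfl | hba
  · exact hbc
  rcases eq_or_ne b c with rfl | hne
  · exact hab
  obtain ⟨r, hr, hrba⟩ := hP.exists_level_one_eq_pair_of_linked hxy hb ha hab.symm hba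
  obtain ⟨r', hr', hrbc⟩ := hP.exists_level_one_eq_pair_of_linked hxy hb hc hbc hne
  obtain ⟨s, hsy, hrs, hrs'⟩ :=
    (hP.isBooleanInterval_of_mem_level_one hxy hb).exists_lt_of_mem_level_one hm hr hr'
  exact ⟨s, hsy, (hrba.superset (mem_insert_of_mem b rfl)).2.trans hrs,
    (hrbc.superset (mem_insert_of_mem b rfl)).2.trans hrs'⟩

theorem ncard_linked [Finite P] (hm : 2 < m) (ha : a ∈ level x y 1) :
    {b ∈ level x y 1 | Linked y a b}.ncard = m + 1 := by
  have hay : a < y := hxy.lt_of_mem_level (by omega) ha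
  have hay' : IsNInterval m a y := (Nat.add_comm m 1 ▸ hxy).right_of_add ha.1 ha.2
  have hlt {r : P} (hr : r ∈ level a y 1) : r < y := hay'.lt_of_mem_level (by omega) hr
  choose! other hother hne hpair using
    fun r (hr : r ∈ level a y 1) => hP.exists_ne_level_one_eq_pair hm.le ha hr
  have hinj : InjOn other (level a y 1) := fun r hr r' hr' heq => by
    have hrr' : level x r 1 = level x r' 1 := by rw [hpair r hr, hpair r' hr', heq]
    have hx {r : P} (hr : r ∈ level a y 1) : x ≤ r := ha.1.1.trans hr.1.1
    exact le_antisymm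
      (hP.le_of_level_one_subset_of_lt hxy hm (hx hr) (hlt hr) ⟨hx hr', hr'.2⟩ hrr'.subset)
      (hP.le_of_level_one_subset_of_lt hxy hm (hx hr') (hlt hr') ⟨hx hr, hr.2⟩ hrr'.superset)
  have himage : other '' level a y 1 = {b ∈ level x y 1 | Linked y a b} \ {a} := by
    refine Subset.antisymm (image_subset_iff.2 fun r hr => ⟨⟨hother r hr, r, hlt hr, hr.1.1, ?_⟩,
      (hne r hr).symm⟩) ?_
    · exact ((hpair r hr).superset (mem_insert_of_mem a rfl)).2
    · rintro b ⟨⟨hb, hab⟩, hba⟩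
      obtain ⟨r, hr, hrab⟩ := hP.exists_level_one_eq_pair_of_linked hxy ha hb hab (Ne.symm hba)
      have hother_mem : other r ∈ ({a, b} : Set P) := by simp [← hrab, hpair r hr]
      exact ⟨r, hr, hother_mem.resolve_left (hne r hr).symm⟩
  have hself : a ∈ {b ∈ level x y 1 | Linked y a b} := ⟨ha, a, hay, le_rfl, le_rfl⟩
  rw [← ncard_sdiff_singleton_add_one hself, ← himage, hinj.ncard_image,
    hP.ncard_level_of_isNInterval hay' le_rfl, Nat.choose_one_right]

theorem exists_level_one_eq_of_ssubset_linked [Finite P] (hm : 2 < m) (ha : a ∈ level x y 1)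
    {T : Set P} (hT : T ⊂ {b ∈ level x y 1 | Linked y a b}) : ∃ z ∈ Ico x y, level x z 1 = T := by
  rcases T.eq_empty_or_nonempty with rfl | ⟨b, hbT⟩
  · exact ⟨x, ⟨le_rfl, hxy.lt m.succ_pos⟩, level_one_self⟩
  have hb := (hT.subset hbT).1
  have hab := (hT.subset hbT).2
  have hby := hP.isBooleanInterval_of_mem_level_one hxy hb
  -- In the boolean interval `[b, y]`, join the rank two elements above `b` whose atoms are in `T`.
  obtain ⟨z, hz, hzT⟩ := hby.exists_level_one_eq
    (T := {r ∈ level b y 1 | level x r 1 ⊆ T}) (sep_subset _ _)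
  have hzy : z ≠ y := by
    rintro rfl
    obtain ⟨c, ⟨hc, hac⟩, hcT⟩ := exists_of_ssubset hT
    obtain ⟨r, hr, hrbc⟩ := hP.exists_level_one_eq_pair_of_linked hxy hb hc
      (hP.linked_trans hxy hm hb ha hc hab.symm hac) (ne_of_mem_of_not_mem hbT hcT)
    have hrT : level x r 1 ⊆ T := (hzT ▸ hr : r ∈ {r ∈ level b z 1 | level x r 1 ⊆ T}).2
    exact hcT (hrT (hrbc ▸ mem_insert_of_mem b rfl))
  have hzy := lt_of_le_of_ne hz.2 hzy
  refine ⟨z, ⟨hb.1.1.trans hz.1, hzy⟩, Subset.antisymm (fun c hc => ?_) fun c hc => ?_⟩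
  all_goals rcases eq_or_ne b c with rfl | hbc
  · exact hbT
  · obtain ⟨r, hr, hrbc⟩ := hP.exists_level_one_eq_pair hxy hzy ⟨hb.1, hz.1⟩ hc hbc
    exact (hzT.subset hr).2 (hrbc ▸ mem_insert_of_mem b rfl)
  · exact ⟨hb.1, hz.1⟩
  · obtain ⟨hcy, hac⟩ := hT.subset hc
    obtain ⟨r, hr, hrbc⟩ := hP.exists_level_one_eq_pair_of_linked hxy hb hcy
      (hP.linked_trans hxy hm hb ha hcy hab.symm hac) hbc
    have hrz : r ∈ level b z 1 := hzT ▸ ⟨hr, hrbc ▸ pair_subset hbT hc⟩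
    exact ⟨hcy.1, (hrbc.superset (mem_insert_of_mem b rfl)).2.trans hrz.2⟩

theorem level_one_ssubset_linked [Finite P] (hm : 2 < m) (hzy : z < y) (ha : a ∈ level x z 1) :
    level x z 1 ⊂ {b ∈ level x y 1 | Linked y a b} := by
  have hxz := ha.1.1.trans ha.2
  refine ssubset_of_subset_of_ne
    (fun b hb => ⟨level_mono_right hzy.le hb, z, hzy, ha.2, hb.2⟩) fun heq => ?_
  have hcard := (hP.isBooleanInterval_of_lt_right hxy hxz hzy).ncard_level 1
  rw [heq, hP.ncard_linked hxy hm (level_mono_right hzy.le ha), Nat.choose_one_right] at hcard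
  have := grade_lt_grade hzy
  have := hxy.2
  omega

theorem exists_atom_coordinates [Finite P] (hm : 2 < m) :
    ∃ k, ∃ e : level x y 1 ≃ Fin k × Fin (m + 1),
      ∀ a b : level x y 1, Linked y a.1 b.1 ↔ (e a).1 = (e b).1 := by
  let s : Setoid (level x y 1) :=
    { r a b := Linked y a.1 b.1
      iseqv :=
        { refl a := ⟨a, hxy.lt_of_mem_level (by omega) a.2, le_rfl, le_rfl⟩
          symm := Linked.symm
          trans {a b c} := hP.linked_trans hxy hm a.2 b.2 c.2 } }
  refine exists_equiv_fin_prod s fun a => ?_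
  rw [← hP.ncard_linked hxy hm a.2, ← ncard_image_of_injective _ Subtype.val_injective]
  congr 1
  ext b
  exact ⟨fun ⟨b, hab, hb⟩ => hb ▸ ⟨b.2, hab⟩, fun hb => ⟨⟨b, hb.1⟩, hb.2, rfl⟩⟩

end

end BooleanUpTo

namespace Copies

theorem le_iff {Q : Type*} [PartialOrder Q] [BoundedOrder Q] {p q : Copies k Q} :
    p ≤ q ↔ p.val = ⊥ ∨ q.val = ⊤ ∨ p.idx = q.idx ∧ p.val ≤ q.val := Iff.rfl

variable {α : Type*} {n : ℕ} {f : Fin k × Fin n → α} {p q : Copies k (BooleanLattice n)}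

/-- The set of points which `p`, an element of one of `k` copies of a boolean lattice, contains when
`f (i, j)` is the `j`-th point of the `i`-th copy. -/
def points (f : Fin k × Fin n → α) (p : Copies k (BooleanLattice n)) : Set α :=
  (fun j => f (p.idx, j)) '' p.val

theorem points_subset_points_iff (hf : f.Injective) :
    p.points f ⊆ q.points f ↔ p.val = ⊥ ∨ p.idx = q.idx ∧ p.val ≤ q.val := by
  refine ⟨fun h => ?_, ?_⟩
  · rcases p.val.eq_empty_or_nonempty with hp | ⟨j, hj⟩
    · exact Or.inl hp
    have hmem {j : Fin n} (hj : j ∈ p.val) : p.idx = q.idx ∧ j ∈ q.val := by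
      obtain ⟨l, hl, heq⟩ := h (mem_image_of_mem _ hj)
      obtain ⟨hidx, rfl⟩ := Prod.mk.inj (hf heq)
      exact ⟨hidx.symm, hl⟩
    exact Or.inr ⟨(hmem hj).1, fun _ hl => (hmem hl).2⟩
  · rintro (hp | ⟨hidx, hval⟩)
    · simp [points, hp]
    · simpa only [points, hidx] using image_mono (Finset.coe_subset.2 hval)

theorem exists_points_eq {i : Fin k} {T : Set α} (hT : T ⊆ points f ⟨i, ⊤⟩) :
    ∃ S, points f ⟨i, S⟩ = T := by
  classical
  refine ⟨Finset.univ.filter fun j => f (i, j) ∈ T, ?_⟩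
  ext a
  refine ⟨?_, fun ha => ?_⟩
  · rintro ⟨j, hj, rfl⟩
    exact (Finset.mem_filter.1 hj).2
  · obtain ⟨j, -, rfl⟩ := hT ha
    exact ⟨j, Finset.mem_filter.2 ⟨Finset.mem_univ j, ha⟩, rfl⟩

end Copies

theorem nonempty_orderIso_kSummation {α β : Type*} [PartialOrder β] {n : ℕ} (hk : 0 < k)
    {t : β} (ht : IsTop t) {f : Fin k × Fin n → α} (hf : f.Injective) (g : β → Set α)
    (hle : ∀ z ≠ t, ∀ w ≠ t, g z ⊆ g w ↔ z ≤ w)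
    (hg : ∀ z ≠ t, ∃ p : Copies k (BooleanLattice n), p.val ≠ ⊤ ∧ p.points f = g z)
    (hpts : ∀ p : Copies k (BooleanLattice n), p.val ≠ ⊤ → ∃ z ≠ t, g z = p.points f) :
    Nonempty (β ≃o KSummation k (BooleanLattice n)) := by
  have hex (p : Copies k (BooleanLattice n)) :
      ∃ z, (p.val = ⊤ → z = t) ∧ (p.val ≠ ⊤ → z ≠ t ∧ g z = p.points f) := by
    by_cases hp : p.val = ⊤
    · exact ⟨t, fun _ => rfl, fun h => absurd hp h⟩
    · exact (hpts p hp).imp fun z hz => ⟨fun h => absurd h hp, fun _ => hz⟩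
  choose φ hφtop hφ using hex
  refine nonempty_orderIso_antisymmetrization φ (fun p q => ?_) fun z => ?_
  · rw [Copies.le_iff]
    by_cases hq : q.val = ⊤
    · exact iff_of_true (hφtop q hq ▸ ht _) (Or.inr (Or.inl hq))
    by_cases hp : p.val = ⊤
    · rw [hφtop p hp, hp]
      refine iff_of_false (fun h => (hφ q hq).1 ((ht _).antisymm h)) ?_
      rintro (h | h | ⟨-, h⟩)
      exacts [hq (top_le_iff.1 (h.trans_le bot_le)), hq h, hq (top_le_iff.1 h)]
    rw [← hle _ (hφ p hp).1 _ (hφ q hq).1, (hφ p hp).2, (hφ q hq).2,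
      Copies.points_subset_points_iff hf, or_iff_right hq]
  · by_cases hz : z = t
    · exact ⟨⟨⟨0, hk⟩, ⊤⟩, (hφtop _ rfl).trans hz.symm⟩
    · obtain ⟨p, hp, hpz⟩ := hg z hz
      obtain ⟨hpt, hφp⟩ := hφ p hp
      have heq : g (φ p) = g z := hφp.trans hpz
      exact ⟨p, le_antisymm ((hle _ hpt _ hz).1 heq.subset) ((hle _ hz _ hpt).1 heq.superset)⟩

namespace BooleanUpTo

theorem setOf_linked_eq_points (e : level x y 1 ≃ Fin k × Fin (m + 1))
    (he : ∀ a b : level x y 1, Linked y a.1 b.1 ↔ (e a).1 = (e b).1) (a : level x y 1) :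
    {b ∈ level x y 1 | Linked y a b} = Copies.points (fun p => (e.symm p : P)) ⟨(e a).1, ⊤⟩ := by
  ext b
  constructor
  · rintro ⟨hb, hab⟩
    refine ⟨(e ⟨b, hb⟩).2, Finset.mem_univ _, ?_⟩
    simp only [(he a ⟨b, hb⟩).1 hab, Prod.mk.eta, e.symm_apply_apply]
  · rintro ⟨j, -, rfl⟩
    exact ⟨(e.symm _).2, (he a _).2 (by rw [e.apply_symm_apply])⟩

section

variable [Finite P] (hP : BooleanUpTo P m) (hxy : IsNInterval (m + 1) x y) (hm : 2 < m)
  (e : level x y 1 ≃ Fin k × Fin (m + 1))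
  (he : ∀ a b : level x y 1, Linked y a.1 b.1 ↔ (e a).1 = (e b).1)
include hP hxy hm he

theorem exists_points_eq_level_one (hk : 0 < k) (hzy : z < y) :
    ∃ p : Copies k (BooleanLattice (m + 1)),
      p.val ≠ ⊤ ∧ p.points (fun p => (e.symm p : P)) = level x z 1 := by
  rcases (level x z 1).eq_empty_or_nonempty with hempty | ⟨a, ha⟩
  · exact ⟨⟨⟨0, hk⟩, ⊥⟩, bot_ne_top, by simp [Copies.points, hempty]⟩
  have hssub := hP.level_one_ssubset_linked hxy hm hzy ha
  rw [setOf_linked_eq_points e he ⟨a, level_mono_right hzy.le ha⟩] at hssub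
  obtain ⟨S, hS⟩ := Copies.exists_points_eq hssub.subset
  refine ⟨⟨_, S⟩, ?_, hS⟩
  rintro rfl
  exact hssub.ne hS.symm

theorem exists_level_one_eq_points {p : Copies k (BooleanLattice (m + 1))} (hp : p.val ≠ ⊤) :
    ∃ z ∈ Ico x y, level x z 1 = p.points fun p => (e.symm p : P) := by
  refine hP.exists_level_one_eq_of_ssubset_linked hxy hm (e.symm (p.idx, 0)).2 ?_
  have hinj : (fun p => (e.symm p : P)).Injective := Subtype.val_injective.comp e.symm.injective
  rw [setOf_linked_eq_points e he, e.apply_symm_apply, ssubset_iff_subset_not_subset,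
    Copies.points_subset_points_iff hinj, Copies.points_subset_points_iff hinj]
  exact ⟨Or.inr ⟨rfl, le_top⟩, fun h => h.elim top_ne_bot fun h => hp (top_le_iff.1 h.2)⟩

end

theorem exists_kSummation_of_two_lt [Finite P] (hP : BooleanUpTo P m)
    (hxy : IsNInterval (m + 1) x y) (hm : 2 < m) :
    ∃ k, 0 < k ∧ (level x y 1).ncard = k * (m + 1) ∧
      Nonempty (Icc x y ≃o KSummation k (BooleanLattice (m + 1))) := by
  obtain ⟨k, e, he⟩ := hP.exists_atom_coordinates hxy hm
  have hcard : (level x y 1).ncard = k * (m + 1) := by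
    rw [← Nat.card_coe_set_eq, Nat.card_congr e, Nat.card_prod, Nat.card_fin, Nat.card_fin]
  have hk : 0 < k := by
    obtain ⟨a, ha⟩ := level_one_nonempty (hxy.lt m.succ_pos)
    exact (e ⟨a, ha⟩).1.pos
  have hlt (z : Icc x y) (hz : z ≠ ⟨y, right_mem_Icc.2 hxy.1⟩) : (z : P) < y :=
    lt_of_le_of_ne z.2.2 fun h => hz (Subtype.ext h)
  refine ⟨k, hk, hcard, nonempty_orderIso_kSummation hk (t := ⟨y, right_mem_Icc.2 hxy.1⟩)
    (fun z => z.2.2) (Subtype.val_injective.comp e.symm.injective) (fun z => level x z 1)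
    (fun z hz w _ => ?_) (fun z hz => ?_) fun p hp => ?_⟩
  · exact ⟨hP.le_of_level_one_subset_of_lt hxy hm z.2.1 (hlt z hz) w.2, fun h => level_mono_right h⟩
  · exact hP.exists_points_eq_level_one hxy hm e he hk (hlt z hz)
  · obtain ⟨z, hz, hzp⟩ := hP.exists_level_one_eq_points hxy hm e he hp
    exact ⟨⟨z, hz.1, hz.2.le⟩, fun h => hz.2.ne (congrArg Subtype.val h), hzp⟩

theorem exists_kSummation [Finite P] (h3 : BooleanUpTo P 3) (hP : BooleanUpTo P m) (hm : 2 ≤ m)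
    (hxy : IsNInterval (m + 1) x y) :
    ∃ k, 0 < k ∧ (level x y 1).ncard = k * (m + 1) ∧
      Nonempty (Icc x y ≃o KSummation k (BooleanLattice (m + 1))) := by
  rcases hm.eq_or_lt with rfl | hm
  · obtain ⟨f⟩ := nonempty_orderIso_kSummation_one (BooleanLattice 3)
    obtain ⟨e⟩ := h3 3 le_rfl x y hxy
    refine ⟨1, one_pos, ?_, ⟨e.trans f⟩⟩
    rw [h3.ncard_level_of_isNInterval hxy le_rfl, Nat.choose_one_right]
  · exact hP.exists_kSummation_of_two_lt hxy hm

end BooleanUpTo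

end KSummation

section Euler

theorem sum_range_neg_one_pow_mul_eq {f : ℕ → ℤ} {m : ℕ} (hm : 0 < m) (heven : Even m)
    (hf : ∀ i, 0 < i → i < m → f (i + 1) = 0) :
    ∑ i ∈ Finset.range (m + 3), (-1) ^ i * f i = f 0 - f 1 - f (m + 1) + f (m + 2) := by
  obtain ⟨j, rfl⟩ := Nat.exists_eq_succ_of_ne_zero hm.ne'
  have hinner : ∑ i ∈ Finset.range j, (-1) ^ (i + 1 + 1) * f (i + 1 + 1) = 0 :=
    Finset.sum_eq_zero fun i hi => by
      rw [hf (i + 1) i.succ_pos (Nat.succ_lt_succ (Finset.mem_range.1 hi)), mul_zero]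
  have hodd : Odd (j + 2) := heven.add_one
  have heven' : Even (j + 3) := heven.add even_two
  rw [Finset.sum_range_succ, Finset.sum_range_succ, Finset.sum_range_succ',
    Finset.sum_range_succ', hinner, hodd.neg_one_pow, heven'.neg_one_pow]
  ring

theorem eq_one_of_euler_relation {n k k' L a b : ℕ} (hn : 4 ≤ n) (hL : 0 < L) (ha : a * k' = L)
    (hb : b * k = L) (h : n * (a + b) + 2 * L = 2 * n + 2 * (n * L)) :
    k' = 1 ∧ k = 1 ∧ a = n := by
  have le_of_mul_eq {c l : ℕ} (hcl : c * l = L) : c ≤ L :=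
    Nat.le_of_dvd hL ⟨l, hcl.symm⟩
  have two_mul_le {c l : ℕ} (hcl : c * l = L) (hl : l ≠ 1) : 2 * c ≤ L := by
    have hl0 : l ≠ 0 := by rintro rfl; omega
    calc 2 * c = c * 2 := mul_comm 2 c
      _ ≤ c * l := Nat.mul_le_mul_left c (by omega)
      _ = L := hcl
  have hsum : 3 * L < 2 * (a + b) := by nlinarith
  have hk' : k' = 1 := by
    by_contra hne
    linarith [two_mul_le ha hne, le_of_mul_eq hb]
  have hk : k = 1 := by
    by_contra hne
    linarith [two_mul_le hb hne, le_of_mul_eq ha]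
  subst hk hk'
  refine ⟨rfl, rfl, ?_⟩
  rw [mul_one] at ha hb
  subst ha hb
  linarith

namespace BooleanUpTo

variable {P : Type*} [PartialOrder P] [GradeMinOrder ℕ P] [Finite P] {x y z w : P}
  {i k k' m : ℕ}

theorem ncard_level_one_eq (hP : BooleanUpTo P m) (hxy : IsNInterval (m + 1) x y)
    (hzw : IsNInterval (m + 1) z w) (h : numMaxChains x y = numMaxChains z w) :
    (level x y 1).ncard = (level z w 1).ncard := by
  rw [hP.numMaxChains_eq_mul_factorial hxy, hP.numMaxChains_eq_mul_factorial hzw] at h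
  exact Nat.eq_of_mul_eq_mul_right m.factorial_pos h

section

variable (hP : BooleanUpTo P m) (hxy : IsNInterval (m + 2) x y)
  (hatoms : ∀ a ∈ level x y 1, (level a y 1).ncard = k' * (m + 1))
include hP hxy hatoms

theorem ncard_level_of_mem_level_one {a : P} (ha : a ∈ level x y 1) (hi : 0 < i) (him : i ≤ m) :
    (level a y i).ncard = k' * (m + 1).choose i :=
  hP.ncard_level_eq_mul_choose ((Nat.add_comm (m + 1) 1 ▸ hxy).right_of_add ha.1 ha.2)
    (hatoms a ha) hi him

theorem add_two_mul_ncard_level (hi : 0 < i) (him : i < m) :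
    (m + 2) * (level x y (i + 1)).ncard =
      (level x y 1).ncard * k' * (m + 2).choose (i + 1) := by
  have hcount : (level x y 1).ncard * (k' * (m + 1).choose i) =
      (level x y (1 + i)).ncard * (1 + i) :=
    ncard_level_mul_ncard_level
      (fun a ha => hP.ncard_level_of_mem_level_one hxy hatoms ha hi him.le) fun w hw => by
        rw [hP.ncard_level_of_isNInterval hw.1 (by omega), Nat.choose_one_right]
  rw [add_comm 1 i] at hcount
  refine Nat.eq_of_mul_eq_mul_right i.succ_pos ?_
  rw [mul_assoc, ← hcount, mul_assoc _ _ (i + 1), ← Nat.add_one_mul_choose_eq]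
  ring

theorem ncard_atoms_mul_eq_ncard_coatoms_mul (hm : 0 < m)
    (hcoatoms : ∀ c ∈ level x y (m + 1), (level x c 1).ncard = k * (m + 1)) :
    (level x y (m + 1)).ncard * k = (level x y 1).ncard * k' := by
  have hcount : (level x y 1).ncard * (k' * (m + 1).choose m) =
      (level x y (1 + m)).ncard * (k * (m + 1)) :=
    ncard_level_mul_ncard_level
      (fun a ha => hP.ncard_level_of_mem_level_one hxy hatoms ha hm le_rfl) fun w hw =>
        hcoatoms w (add_comm 1 m ▸ hw)
  rw [Nat.choose_succ_self_right, add_comm 1 m, ← mul_assoc, ← mul_assoc] at hcount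
  exact (Nat.eq_of_mul_eq_mul_right m.succ_pos hcount).symm

theorem eq_one_of_isEulerian (hE : IsEulerian P) (hm : 2 ≤ m) (heven : Even m) (hk' : 0 < k')
    (hcoatoms : ∀ c ∈ level x y (m + 1), (level x c 1).ncard = k * (m + 1)) :
    k' = 1 ∧ k = 1 ∧ (level x y 1).ncard = m + 2 := by
  set L := (level x y 1).ncard * k'
  have hLpos : 0 < L := Nat.mul_pos
    ((ncard_pos (toFinite _)).2 (level_one_nonempty (hxy.lt (by omega)))) hk'
  refine eq_one_of_euler_relation (by omega) hLpos rfl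
    (hP.ncard_atoms_mul_eq_ncard_coatoms_mul hxy hatoms (by omega) hcoatoms) ?_
  -- In these ranks the level sizes are proportional to those of the boolean lattice, whose own
  -- Euler relation therefore cancels all but the two outermost ranks on either side.
  set f : ℕ → ℤ := fun i => (m + 2) * (level x y i).ncard - L * (m + 2).choose i with hf
  have hfmid (i : ℕ) (hi : 0 < i) (him : i < m) : f (i + 1) = 0 :=
    sub_eq_zero.2 <| by exact_mod_cast hP.add_two_mul_ncard_level hxy hatoms hi him
  have hsum : ∑ i ∈ Finset.range (m + 3), (-1) ^ i * f i = 0 := by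
    simp only [hf, mul_sub, Finset.sum_sub_distrib, mul_left_comm _ (m + 2 : ℤ),
      mul_left_comm _ (L : ℤ), ← Finset.mul_sum]
    rw [hE.sum_neg_one_pow_mul_ncard_level hxy (by omega),
      Int.alternating_sum_range_choose_of_ne (by omega), mul_zero, mul_zero, sub_zero]
  rw [sum_range_neg_one_pow_mul_eq (by omega) heven hfmid] at hsum
  simp only [hf, level_zero hxy.1, hxy.level_self, ncard_singleton, Nat.choose_zero_right,
    Nat.choose_one_right, Nat.choose_succ_self_right, Nat.choose_self] at hsum
  push_cast at hsum
  zify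
  linarith

end

end BooleanUpTo

end Euler

section Sheffer

variable {P : Type*} [PartialOrder P] [BoundedOrder P] [GradeMinOrder ℕ P]
  {x y c c' : P} {m : ℕ}

theorem IsSheffer.numMaxChains_eq_of_left_eq (hS : IsSheffer P) (hc : IsNInterval m x c)
    (hc' : IsNInterval m x c') : numMaxChains x c = numMaxChains x c' := by
  rcases eq_or_ne x ⊥ with rfl | hx
  · exact hS.sheffer_intervals m c c' hc hc'
  · exact hS.binomial_intervals m x c x c' hx hx hc hc'

theorem isNInterval_bot_top : IsNInterval (grade ℕ (⊤ : P)) (⊥ : P) ⊤ :=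
  ⟨bot_le, by rw [grade_bot, bot_eq_zero, zero_add]⟩

variable [Finite P]

namespace BooleanUpTo

section

variable (hE : IsEulerian P) (hS : IsSheffer P) (hP : BooleanUpTo P m) (h3 : BooleanUpTo P 3)
  (hm : 2 ≤ m) (heven : Even m)
include hE hS hP h3 hm heven

theorem ncard_level_one_of_isNInterval_add_two (hxy : IsNInterval (m + 2) x y) :
    (level x y 1).ncard = m + 2 ∧
      (∀ a ∈ level x y 1, (level a y 1).ncard = m + 1) ∧
      ∀ c ∈ level x y (m + 1), (level x c 1).ncard = m + 1 := by
  have hup {a : P} (ha : a ∈ level x y 1) : IsNInterval (m + 1) a y :=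
    (Nat.add_comm (m + 1) 1 ▸ hxy).right_of_add ha.1 ha.2
  have hlt := hxy.lt (by omega)
  obtain ⟨a₀, ha₀⟩ := level_one_nonempty hlt
  obtain ⟨c₀, hxc₀, hc₀y⟩ := exists_le_covBy_of_lt hlt
  have hc₀ : IsNInterval (m + 1) x c₀ :=
    IsNInterval.left_of_add (i := m + 1) hxy hxc₀ (covBy_iff_isNInterval_one.1 hc₀y)
  obtain ⟨k', hk', hka₀, -⟩ := h3.exists_kSummation hP hm (hup ha₀)
  obtain ⟨k, -, hkc₀, -⟩ := h3.exists_kSummation hP hm hc₀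
  have hatoms (a : P) (ha : a ∈ level x y 1) : (level a y 1).ncard = k' * (m + 1) := by
    rw [← hka₀]
    exact hP.ncard_level_one_eq (hup ha) (hup ha₀) <|
      hS.binomial_intervals (m + 1) a y a₀ y (bot_le.trans_lt (ha.1.lt one_pos)).ne'
        (bot_le.trans_lt (ha₀.1.lt one_pos)).ne' (hup ha) (hup ha₀)
  have hcoatoms (c : P) (hc : c ∈ level x y (m + 1)) : (level x c 1).ncard = k * (m + 1) := by
    rw [← hkc₀]
    exact hP.ncard_level_one_eq hc.1 hc₀ (hS.numMaxChains_eq_of_left_eq hc.1 hc₀)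
  obtain ⟨rfl, rfl, hcard⟩ := hP.eq_one_of_isEulerian hxy hatoms hE hm heven hk' hcoatoms
  exact ⟨hcard, by simpa only [one_mul] using hatoms, by simpa only [one_mul] using hcoatoms⟩

theorem ncard_level_one_of_add_two_le (hn : m + 2 ≤ grade ℕ (⊤ : P))
    (hxy : IsNInterval (m + 1) x y) : (level x y 1).ncard = m + 1 := by
  rcases eq_or_ne x ⊥ with rfl | hx
  · have hy : y ≠ ⊤ := by
      rintro rfl
      have := hxy.2; have := (isNInterval_bot_top (P := P)).2; omega
    obtain ⟨w, hyw, -⟩ := exists_covBy_le_of_lt (lt_top_iff_ne_top.2 hy)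
    exact (hP.ncard_level_one_of_isNInterval_add_two hE hS h3 hm heven
      (hxy.trans (covBy_iff_isNInterval_one.1 hyw))).2.2 y ⟨hxy, hyw.le⟩
  · obtain ⟨w, -, hwx⟩ := exists_le_covBy_of_lt (bot_lt_iff_ne_bot.2 hx)
    have hwx' := covBy_iff_isNInterval_one.1 hwx
    have hwy : IsNInterval (m + 2) w y := Nat.add_comm 1 (m + 1) ▸ hwx'.trans hxy
    exact (hP.ncard_level_one_of_isNInterval_add_two hE hS h3 hm heven hwy).2.1 x ⟨hwx', hxy.1⟩

theorem add_two (hn : m + 2 ≤ grade ℕ (⊤ : P)) : BooleanUpTo P (m + 2) := by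
  have hP' : BooleanUpTo P (m + 1) := hP.succ fun x y hxy =>
    hP.isBooleanInterval_of_ncard_level_one hxy <|
      hP.ncard_level_one_of_add_two_le hE hS h3 hm heven hn hxy
  exact hP'.succ fun x y hxy => hP'.isBooleanInterval_of_ncard_level_one hxy
    (hP.ncard_level_one_of_isNInterval_add_two hE hS h3 hm heven hxy).1

end

theorem of_even_le (hE : IsEulerian P) (hS : IsSheffer P) (h3 : BooleanUpTo P 3) (hm : Even m)
    (hle : m ≤ grade ℕ (⊤ : P)) : BooleanUpTo P m := by
  obtain ⟨j, rfl⟩ := hm.two_dvd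
  induction j with
  | zero => exact h3.mono (by omega)
  | succ j ih =>
    rcases j.eq_zero_or_pos with rfl | hj
    · exact h3.mono (by omega)
    · exact (ih (even_two_mul j) (by omega)).add_two (m := 2 * j) hE hS h3 (by omega)
        (even_two_mul j) hle

end BooleanUpTo

end Sheffer

end ShefferPoset

theorem mainTheorem3 {P : Type*} [PartialOrder P] [BoundedOrder P] [Finite P] [GradeMinOrder ℕ P]
    (n : ℕ) (hn : 3 ≤ n) (hrank : grade ℕ (⊤ : P) = n)
    (hEulerian : ShefferPoset.IsEulerian P) (hSheffer : ShefferPoset.IsSheffer P)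
    (B D : ℕ → ℕ) (hB : ShefferPoset.IsBinomialFactorial P B)
    (hD : ShefferPoset.IsShefferFactorial P D) (hB3 : B 3 = 6) (hD3 : D 3 = 6) :
    (Odd n → ∃ k : ℕ, 1 ≤ k ∧
      Nonempty (P ≃o ShefferPoset.KSummation k (ShefferPoset.BooleanLattice n))) ∧
    (Even n → Nonempty (P ≃o ShefferPoset.BooleanLattice n)) := by
  have h3 : ShefferPoset.BooleanUpTo P 3 := hEulerian.booleanUpTo_three fun x y hxy => by
    rcases eq_or_ne x ⊥ with rfl | hx
    · rw [hD 3 y hxy, hD3]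
    · rw [hB 3 x y hx hxy, hB3]
  have hbot_top : ShefferPoset.IsNInterval n (⊥ : P) ⊤ :=
    hrank ▸ ShefferPoset.isNInterval_bot_top
  have hboolean {m : ℕ} (hm : Even m) (hmn : m ≤ n) : ShefferPoset.BooleanUpTo P m :=
    .of_even_le hEulerian hSheffer h3 hm (hmn.trans_eq hrank.symm)
  let e : P ≃o Set.Icc (⊥ : P) ⊤ :=
    OrderIso.Set.univ.symm.trans (OrderIso.setCongr _ _ Set.Icc_bot_top.symm)
  refine ⟨fun hodd => ?_, fun heven => ?_⟩
  · obtain ⟨m, rfl⟩ : ∃ m, n = m + 1 := ⟨n - 1, by omega⟩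
    have hm : Even m := by simpa only [Nat.odd_add_one, Nat.not_odd_iff_even] using hodd
    obtain ⟨k, hk, -, ⟨f⟩⟩ :=
      h3.exists_kSummation (hboolean hm m.le_succ) (by omega) hbot_top
    exact ⟨k, hk, ⟨e.trans f⟩⟩
  · obtain ⟨f⟩ := hboolean heven le_rfl n le_rfl ⊥ ⊤ hbot_top
    exact ⟨e.trans f⟩
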